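/- Let $X\in\mathbb{R}^{n\times m}$ be a fixed design matrix with $X^{T}X=I_m$, let $\beta\in\mathbb{R}^m$, and let $y=X\beta+\epsilon$ with $\epsilon\sim N(0,\sigma^2I_n)$, where $\sigma\ge 0$ is known. Let $\alpha,\gamma\in(0,1)$, let $\Phi$ be the cumulative distribution function of the standard normal distribution, and for $i=1,\dots,m$ put $$\lambda_i=\Phi^{-1}\!\left(1-\frac{(\lfloor\gamma i\rfloor+1)\,\alpha}{2\,(m+\lfloor\gamma i\rfloor+1-i)}\right).$$ Let $\hat\beta$ be the F-SLOPE estimate, that is, a minimizer over $b\in\mathbb{R}^m$ of $$\frac12\|y-Xb\|_2^2+\sigma\sum_{i=1}^m\lambda_i|b|_{(i)},$$ where $|b|_{(1)}\ge|b|_{(2)}\ge\dots\ge|b|_{(m)}$ are the absolute values of the coordinates of $b$ in non-increasing order. Let $R=\#\{j:\hat\beta_j\ne0\}$ be the number of selected features, $V=\#\{j:\hat\beta_j\neq 0,\ \beta_j=0\}$ the number of falsely selected features, and $\mathrm{FDP}=V/\max\{R,1\}$. Then $$\mathrm{Prob}(\mathrm{FDP}>\gamma)\le\alpha .$$ -/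

import Mathlib

open MeasureTheory ProbabilityTheory
open scoped Matrix

noncomputable section

namespace FSlope

/-- The quantile function `Φ⁻¹` of the standard normal distribution, `Φ` being its cumulative
distribution function; on `(0, 1)` it is the inverse function of `Φ`. -/
def stdNormalQuantile (p : ℝ) : ℝ :=
  sInf {x : ℝ | p ≤ cdf (gaussianReal 0 1) x}

/-- The F-SLOPE weight `λ_i` for `m` features at levels `γ`, `α`, with `i = 1, …, m`. -/
def lam (m : ℕ) (γ α : ℝ) (i : ℕ) : ℝ :=
  stdNormalQuantile
    (1 - ((⌊γ * (i : ℝ)⌋₊ : ℝ) + 1) * α / (2 * ((m : ℝ) + (⌊γ * (i : ℝ)⌋₊ : ℝ) + 1 - (i : ℝ))))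

/-- The absolute values of the coordinates of `b` in non-increasing order:
`sortedAbs b i` is `|b|_(i+1)`. -/
def sortedAbs {m : ℕ} (b : EuclideanSpace ℝ (Fin m)) (i : Fin m) : ℝ :=
  |b (Tuple.sort (fun j => -|b j|) i)|

theorem sortedAbs_antitone {m : ℕ} (b : EuclideanSpace ℝ (Fin m)) : Antitone (sortedAbs b) := by
  intro i j hij
  have h := Tuple.monotone_sort (fun j => -|b j|) hij
  simpa [sortedAbs] using h

/-- The objective `½‖y - X b‖² + σ ∑ᵢ λᵢ |b|_(i)` of F-SLOPE. -/
def objective {n m : ℕ} (X : Matrix (Fin n) (Fin m) ℝ) (σ γ α : ℝ)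
    (y : EuclideanSpace ℝ (Fin n)) (b : EuclideanSpace ℝ (Fin m)) : ℝ :=
  1 / 2 * ‖y - WithLp.toLp 2 (X *ᵥ b)‖ ^ 2
    + σ * ∑ i : Fin m, lam m γ α ((i : ℕ) + 1) * sortedAbs b i

/-- `b` is an F-SLOPE estimate for the response `y`: it minimizes the objective over `ℝᵐ`. -/
def IsEstimate {n m : ℕ} (X : Matrix (Fin n) (Fin m) ℝ) (σ γ α : ℝ)
    (y : EuclideanSpace ℝ (Fin n)) (b : EuclideanSpace ℝ (Fin m)) : Prop :=
  ∀ b' : EuclideanSpace ℝ (Fin m), objective X σ γ α y b ≤ objective X σ γ α y b'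

open Classical in
/-- The number `R` of selected features of an estimate `b`. -/
def numSelected {m : ℕ} (b : EuclideanSpace ℝ (Fin m)) : ℕ :=
  (Finset.univ.filter fun j : Fin m => b j ≠ 0).card

open Classical in
/-- The number `V` of falsely selected features of an estimate `b`, for the true `β`. -/
def numFalse {m : ℕ} (β b : EuclideanSpace ℝ (Fin m)) : ℕ :=
  (Finset.univ.filter fun j : Fin m => b j ≠ 0 ∧ β j = 0).card

/-- The false discovery proportion `V / max {R, 1}`. -/
def fdp {m : ℕ} (β b : EuclideanSpace ℝ (Fin m)) : ℝ :=
  (numFalse β b : ℝ) / (max (numSelected b) 1 : ℕ)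

end FSlope

end

/-! ### Selections: uniqueness and deletion of one coordinate -/

namespace FSlope

/-! Since XᵀX = I, the least squares term is, up to a constant, ½‖z - b‖² with z = Xᵀy, whose
coordinates are independent N(β_i, σ²). First-order conditions describe the support S of a minimizer
through z alone (`isSelection_support_of_isMinimizer`) and determine it uniquely (`IsSelection.eq`).
If i ∈ S and |S| = r, then |z_i| > σλ_r, and S \ {i} is the selection at the other coordinates with
the largest weight dropped (`IsSelection.erase`). These two events are independent. For a null i the
first has probability at most 2 · `level m γ α r`; the second, over all possible sets, are disjoint,
so their probabilities sum to at most 1.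

Let m₀ be the number of nulls. If FDP > γ and R = r, then V ≥ max(⌊γr⌋ + 1, r + m₀ - m). Giving each
selected null the reciprocal of this bound as its share makes the total at least 1, so by Markov the
probability is at most the expected total. The weights are such that the reciprocal times 2 · `level
m γ α r` is at most α/m₀ for every r (`level_div_max_le`), so the m₀ nulls contribute at most α
together (`measure_isSelection_le`). -/

theorem sum_range_le_sum_of_lt {w : ℕ → ℝ} (hw : Antitone w) (U : Finset ℕ) :
    ∀ r, (∀ k ∈ U, k < r) →
      ∑ k ∈ Finset.range U.card, w (r - U.card + k) ≤ ∑ k ∈ U, w k := by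
  induction U using Finset.induction_on_max with
  | empty => simp
  | insert a s ha ih =>
    intro r hr
    have has : a ∉ s := fun h => lt_irrefl _ (ha a h)
    have har : a < r := hr a (Finset.mem_insert_self _ _)
    have hcard : s.card ≤ a := by
      have : s ⊆ Finset.range a := fun x hx => Finset.mem_range.2 (ha x hx)
      simpa using Finset.card_le_card this
    rw [Finset.sum_insert has, Finset.card_insert_of_notMem has, Finset.sum_range_succ, add_comm]
    have h1 : r - (s.card + 1) + s.card = r - 1 := by omega
    rw [h1]
    refine add_le_add (hw (by omega)) ?_
    have := ih (r - 1) (fun k hk => by have := ha k hk; omega)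
    rwa [Nat.sub_sub, add_comm 1] at this

theorem sum_le_sum_range_of_ge {w : ℕ → ℝ} (hw : Antitone w) (r : ℕ) (U : Finset ℕ)
    (hU : ∀ k ∈ U, r ≤ k) :
    ∑ k ∈ U, w k ≤ ∑ k ∈ Finset.range U.card, w (r + k) := by
  induction U using Finset.induction_on_max with
  | empty => simp
  | insert a s ha ih =>
    have has : a ∉ s := fun h => lt_irrefl _ (ha a h)
    have hcard : r + s.card ≤ a := by
      have : s ⊆ Finset.Ico r a := fun x hx =>
        Finset.mem_Ico.2 ⟨hU x (Finset.mem_insert_of_mem hx), ha x hx⟩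
      have h2 := Finset.card_le_card this
      have h3 := hU a (Finset.mem_insert_self _ _)
      rw [Nat.card_Ico] at h2
      omega
    rw [Finset.sum_insert has, Finset.card_insert_of_notMem has, Finset.sum_range_succ, add_comm]
    exact add_le_add (ih fun k hk => hU k (Finset.mem_insert_of_mem hk)) (hw hcard)

/-- The first-order conditions which characterize the support `S` of the sorted `ℓ¹` proximal
operator, with weights `w 0 ≥ w 1 ≥ …`, at the vector of the coordinates `z j` with `j ∈ U`. -/
def IsSelection {ι : Type*} (w : ℕ → ℝ) (U S : Finset ι) (z : ι → ℝ) : Prop :=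
  S ⊆ U ∧
  (∀ T ⊆ S, T.Nonempty →
    ∑ k ∈ Finset.range T.card, w (S.card - T.card + k) < ∑ j ∈ T, |z j|) ∧
  (∀ T ⊆ U, Disjoint T S → ∑ j ∈ T, |z j| ≤ ∑ k ∈ Finset.range T.card, w (S.card + k))

variable {ι : Type*}

theorem IsSelection.lt_abs {w : ℕ → ℝ} {U S : Finset ι} {z : ι → ℝ} (h : IsSelection w U S z)
    {i : ι} (hi : i ∈ S) : w (S.card - 1) < |z i| := by
  simpa using h.2.1 {i} (by simpa using hi) (by simp)

theorem measurableSet_isSelection (w : ℕ → ℝ) (U S : Finset ι) :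
    MeasurableSet {z : ι → ℝ | IsSelection w U S z} := by
  have h (T : Finset ι) : Measurable fun z : ι → ℝ => ∑ j ∈ T, |z j| :=
    Finset.measurable_sum _ fun j _ => (measurable_pi_apply j).abs
  refine (MeasurableSet.const _).inter (MeasurableSet.inter ?_ ?_)
  · have : {z : ι → ℝ | ∀ T ⊆ S, T.Nonempty →
        ∑ k ∈ Finset.range T.card, w (S.card - T.card + k) < ∑ j ∈ T, |z j|} =
        ⋂ T ∈ S.powerset, {z | T.Nonempty →
        ∑ k ∈ Finset.range T.card, w (S.card - T.card + k) < ∑ j ∈ T, |z j|} := by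
      ext z; simp
    change MeasurableSet {z : ι → ℝ | _}
    rw [this]
    refine Finset.measurableSet_biInter _ fun T _ => ?_
    exact (MeasurableSet.const _).imp (measurableSet_lt measurable_const (h T))
  · have : {z : ι → ℝ | ∀ T ⊆ U, Disjoint T S →
        ∑ j ∈ T, |z j| ≤ ∑ k ∈ Finset.range T.card, w (S.card + k)} =
        ⋂ T ∈ U.powerset, {z | Disjoint T S →
        ∑ j ∈ T, |z j| ≤ ∑ k ∈ Finset.range T.card, w (S.card + k)} := by
      ext z; simp
    change MeasurableSet {z : ι → ℝ | _}
    rw [this]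
    refine Finset.measurableSet_biInter _ fun T _ => ?_
    exact (MeasurableSet.const _).imp (measurableSet_le (h T) measurable_const)

variable [DecidableEq ι]

/-- For T = S' \ S, selection of S' bounds ∑_T |z_j| strictly below by weights starting at index |S'
∩ S|, and selection of S bounds it above by weights starting at |S| ≥ |S' ∩ S|. As w is antitone, T
must be empty. -/
theorem IsSelection.subset_of_card_le {w : ℕ → ℝ} (hw : Antitone w) {U S S' : Finset ι}
    {z : ι → ℝ} (h : IsSelection w U S z) (h' : IsSelection w U S' z) : S' ⊆ S := by
  by_contra hne
  have hT : (S' \ S).Nonempty := Finset.sdiff_nonempty.2 hne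
  have h1 := h'.2.1 (S' \ S) Finset.sdiff_subset hT
  have h2 := h.2.2 (S' \ S) (Finset.sdiff_subset.trans h'.1) Finset.sdiff_disjoint
  refine absurd (h1.trans_le h2) (not_lt.2 (Finset.sum_le_sum fun k _ => hw ?_))
  have h3 := Finset.card_sdiff_add_card_inter S' S
  have h4 := Finset.card_le_card (Finset.inter_subset_right : S' ∩ S ⊆ S)
  omega

theorem IsSelection.eq {w : ℕ → ℝ} (hw : Antitone w) {U S S' : Finset ι} {z : ι → ℝ}
    (h : IsSelection w U S z) (h' : IsSelection w U S' z) : S = S' :=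
  (h'.subset_of_card_le hw h).antisymm (h.subset_of_card_le hw h')

/-- Removing a selected coordinate together with the largest weight leaves the selection of the
other coordinates unchanged. -/
theorem IsSelection.erase {w : ℕ → ℝ} {U S : Finset ι} {z : ι → ℝ} (h : IsSelection w U S z)
    {i : ι} (hi : i ∈ S) :
    IsSelection (fun k => w (k + 1)) (U.erase i) (S.erase i) z := by
  have hc := Finset.card_erase_add_one hi
  refine ⟨Finset.erase_subset_erase _ h.1, fun T hT hTn => ?_, fun T hT hTS => ?_⟩
  · refine lt_of_eq_of_lt (Finset.sum_congr rfl fun k _ => ?_)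
      (h.2.1 T (hT.trans (Finset.erase_subset _ _)) hTn)
    have := Finset.card_le_card hT
    change w (_ + 1) = w _
    congr 1
    omega
  · refine (h.2.2 T (hT.trans (Finset.erase_subset _ _)) ?_).trans
      (le_of_eq (Finset.sum_congr rfl fun k _ => ?_))
    · rw [Finset.disjoint_left] at hTS ⊢
      intro j hj hjS
      exact hTS hj (Finset.mem_erase.2 ⟨(Finset.mem_erase.1 (hT hj)).1, hjS⟩)
    · change w _ = w (_ + 1)
      congr 1
      omega

end FSlope

/-! ### Optimality conditions for the sorted ℓ¹ penalty -/

namespace FSlope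

/-- The positions of a strictly dominating set S form an initial segment of length |S|, however ties
inside S are broken. -/
theorem sort_symm_lt_card_iff {m : ℕ} (c : EuclideanSpace ℝ (Fin m)) (S : Finset (Fin m))
    (hS : ∀ j ∈ S, ∀ j' ∉ S, |c j'| < |c j|) (j : Fin m) :
    ((Tuple.sort (fun j => -|c j|)).symm j : ℕ) < S.card ↔ j ∈ S := by
  set τ := Tuple.sort (fun j => -|c j|) with hτ
  have hlow : ∀ i i' : Fin m, i ≤ i' → τ i' ∈ S → τ i ∈ S := by
    intro i i' hii' h
    by_contra hn
    exact absurd (sortedAbs_antitone c hii') (not_le.2 (hS _ h _ hn))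
  have hcard : (S.map τ.symm.toEmbedding).card = S.card := Finset.card_map _
  have hmem : ∀ i, i ∈ S.map τ.symm.toEmbedding ↔ τ i ∈ S := by
    intro i; simp [Finset.mem_map_equiv]
  constructor
  · intro h
    by_contra hn
    have : S.map τ.symm.toEmbedding ⊆ Finset.Iio (τ.symm j) := by
      intro i hi
      rw [Finset.mem_Iio]
      by_contra hle
      exact hn (by simpa using hlow _ _ (not_lt.1 hle) ((hmem i).1 hi))
    have := Finset.card_le_card this
    rw [hcard, Fin.card_Iio] at this
    omega
  · intro h
    have : Finset.Iic (τ.symm j) ⊆ S.map τ.symm.toEmbedding := by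
      intro i hi
      exact (hmem i).2 (hlow _ (τ.symm j) (Finset.mem_Iic.1 hi) (by simpa using h))
    have := Finset.card_le_card this
    rw [hcard, Fin.card_Iic] at this
    omega

theorem sum_mul_abs_le_sum_mul_sortedAbs {m : ℕ} {w : ℕ → ℝ} (hw : Antitone w)
    (b : EuclideanSpace ℝ (Fin m)) (τ : Equiv.Perm (Fin m)) :
    ∑ j, w (τ j) * |b j| ≤ ∑ i : Fin m, w i * sortedAbs b i := by
  have hmono : Monovary (fun i : Fin m => w i) (sortedAbs b) := by
    intro i j hij
    have : j ≤ i := le_of_lt (lt_of_not_ge fun h => absurd (sortedAbs_antitone b h) (not_le.2 hij))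
    exact hw (by exact_mod_cast this)
  refine le_trans (le_of_eq ?_) (hmono.sum_comp_perm_mul_le_sum_mul
    (σ := (Tuple.sort (fun j => -|b j|)).trans τ))
  rw [← Equiv.sum_comp (Tuple.sort (fun j => -|b j|))]
  rfl

/-- The increase of the sorted `ℓ¹` norm is at most that of the weighted `ℓ¹` norm whose weights
are ordered as the new vector is. -/
theorem sum_mul_sortedAbs_le {m : ℕ} {w : ℕ → ℝ} (hw : Antitone w)
    (b c : EuclideanSpace ℝ (Fin m)) :
    ∑ i : Fin m, w i * sortedAbs c i ≤ ∑ i : Fin m, w i * sortedAbs b i +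
      ∑ j, w ((Tuple.sort (fun j => -|c j|)).symm j) * (|c j| - |b j|) := by
  set τ := Tuple.sort (fun j => -|c j|) with hτ
  have h1 : ∑ i : Fin m, w i * sortedAbs c i = ∑ j, w (τ.symm j) * |c j| := by
    rw [← Equiv.sum_comp τ fun j => w (τ.symm j) * |c j|]
    simp [sortedAbs, ← hτ]
  have h2 := sum_mul_abs_le_sum_mul_sortedAbs hw b τ.symm
  simp_rw [mul_sub, Finset.sum_sub_distrib]
  linarith

-- One-sided directional derivative at the minimizer: compare b with b + δd, divide by δ and let δ →
-- 0⁺.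
open Filter Topology in
theorem sum_mul_le_of_isMinimizer {m : ℕ} {w : ℕ → ℝ} {z : Fin m → ℝ}
    {b : EuclideanSpace ℝ (Fin m)}
    (hb : ∀ b' : EuclideanSpace ℝ (Fin m),
      1 / 2 * ∑ j, (z j - b j) ^ 2 + ∑ i : Fin m, w i * sortedAbs b i ≤
        1 / 2 * ∑ j, (z j - b' j) ^ 2 + ∑ i : Fin m, w i * sortedAbs b' i)
    (d : EuclideanSpace ℝ (Fin m)) (c : ℝ)
    (h : ∀ᶠ δ in 𝓝[>] (0 : ℝ), ∑ i : Fin m, w i * sortedAbs (b + δ • d) i ≤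
      ∑ i : Fin m, w i * sortedAbs b i + δ * c) :
    ∑ j, d j * (z j - b j) ≤ c := by
  have hlim : Tendsto (fun δ : ℝ => c + δ * (1 / 2 * ∑ j, d j ^ 2)) (𝓝[>] 0) (𝓝 c) := by
    have : Continuous fun δ : ℝ => c + δ * (1 / 2 * ∑ j, d j ^ 2) := by fun_prop
    simpa using (this.tendsto 0).mono_left nhdsWithin_le_nhds
  refine ge_of_tendsto hlim ?_
  filter_upwards [h, self_mem_nhdsWithin] with δ hδ hpos
  rw [Set.mem_Ioi] at hpos
  have h1 := hb (b + δ • d)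
  have h2 : ∑ j, (z j - (b + δ • d) j) ^ 2 =
      ∑ j, (z j - b j) ^ 2 - 2 * δ * ∑ j, d j * (z j - b j) + δ ^ 2 * ∑ j, d j ^ 2 := by
    rw [Finset.mul_sum, Finset.mul_sum, ← Finset.sum_sub_distrib, ← Finset.sum_add_distrib]
    refine Finset.sum_congr rfl fun j _ => ?_
    simp only [PiLp.add_apply, PiLp.smul_apply, smul_eq_mul]
    ring
  rw [h2] at h1
  have h3 : δ * ∑ j, d j * (z j - b j) ≤ δ * (c + δ * (1 / 2 * ∑ j, d j ^ 2)) := by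
    nlinarith
  exact le_of_mul_le_mul_left h3 hpos

open Filter Topology in
theorem eventually_lt_abs {m : ℕ} (b : EuclideanSpace ℝ (Fin m)) :
    ∀ᶠ δ in 𝓝[>] (0 : ℝ), 0 < δ ∧ ∀ j, b j ≠ 0 → δ < |b j| := by
  refine Eventually.and self_mem_nhdsWithin (eventually_all.2 fun j => ?_)
  by_cases hj : b j = 0
  · simp [hj]
  · filter_upwards [Ioo_mem_nhdsGT (abs_pos.2 hj)] with δ hδ _ using hδ.2

-- Move the coordinates in T by a small δ, towards 0 if T ⊆ S and away from 0 if T is disjoint from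
-- S. For small δ the block S still dominates strictly, so T occupies positions below |S|,
-- respectively from |S| on; the extreme choice of such positions gives the weight sums.
open Classical in
theorem isSelection_support_of_isMinimizer {m : ℕ} {w : ℕ → ℝ} (hw : Antitone w) {z : Fin m → ℝ}
    {b : EuclideanSpace ℝ (Fin m)}
    (hb : ∀ b' : EuclideanSpace ℝ (Fin m),
      1 / 2 * ∑ j, (z j - b j) ^ 2 + ∑ i : Fin m, w i * sortedAbs b i ≤
        1 / 2 * ∑ j, (z j - b' j) ^ 2 + ∑ i : Fin m, w i * sortedAbs b' i) :
    IsSelection w Finset.univ (Finset.univ.filter fun j => b j ≠ 0) z := by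
  set S := Finset.univ.filter fun j => b j ≠ 0 with hS
  have hmemS : ∀ j, j ∈ S ↔ b j ≠ 0 := fun j => by simp [hS]
  refine ⟨Finset.subset_univ _, fun T hT hTn => ?_, fun T _ hTS => ?_⟩
  · set s : Fin m → ℝ := fun j => SignType.sign (b j) with hs
    have hsb : ∀ j, s j * b j = |b j| := fun j => by simp [hs, sign_mul_self]
    have hs1 : ∀ j ∈ T, s j * s j = 1 := fun j hj => by
      have := (hmemS j).1 (hT hj)
      rcases lt_or_gt_of_ne this with h | h <;> simp [hs, h]
    have habs : ∀ j ∈ T, |s j| = 1 := fun j hj => by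
      have := hs1 j hj
      rw [← abs_mul_abs_self] at this
      nlinarith [abs_nonneg (s j)]
    have key := sum_mul_le_of_isMinimizer hb
      (WithLp.toLp 2 fun j => if j ∈ T then -s j else 0)
      (-∑ k ∈ Finset.range T.card, w (S.card - T.card + k)) ?_
    · simp only [ite_mul, zero_mul, Finset.sum_ite_mem, Finset.univ_inter] at key
      have h1 : ∑ j ∈ T, -s j * (z j - b j) = ∑ j ∈ T, |b j| - ∑ j ∈ T, s j * z j := by
        rw [← Finset.sum_sub_distrib]
        refine Finset.sum_congr rfl fun j _ => ?_
        rw [← hsb]; ring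
      -- This positive term makes the lower bound strict.
      have h2 : 0 < ∑ j ∈ T, |b j| :=
        Finset.sum_pos (fun j hj => abs_pos.2 ((hmemS j).1 (hT hj))) hTn
      have h3 : ∑ j ∈ T, s j * z j ≤ ∑ j ∈ T, |z j| := Finset.sum_le_sum fun j hj => by
        refine (le_abs_self _).trans ?_
        rw [abs_mul, habs j hj, one_mul]
      linarith
    · filter_upwards [eventually_lt_abs b] with δ ⟨hδ, hδb⟩
      set c : EuclideanSpace ℝ (Fin m) :=
        b + δ • WithLp.toLp 2 fun j => if j ∈ T then -s j else 0 with hc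
      have hcT : ∀ j ∈ T, |c j| = |b j| - δ := fun j hj => by
        have h1 : c j = s j * (|b j| - δ) := by
          have : b j = s j * |b j| := by rw [← hsb, ← mul_assoc, hs1 j hj, one_mul]
          simp only [hc, PiLp.add_apply, PiLp.smul_apply, hj, if_true, smul_eq_mul]
          nlinarith
        rw [h1, abs_mul, habs j hj, one_mul, abs_of_pos]
        linarith [hδb j ((hmemS j).1 (hT hj))]
      have hcn : ∀ j ∉ T, c j = b j := fun j hj => by simp [hc, hj]
      have hblock : ∀ j ∈ S, ∀ j' ∉ S, |c j'| < |c j| := by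
        intro j hj j' hj'
        have hb' : b j' = 0 := by simpa [hmemS] using hj'
        rw [hcn j' (fun h => hj' (hT h)), hb', abs_zero]
        by_cases hjT : j ∈ T
        · rw [hcT j hjT]; linarith [hδb j ((hmemS j).1 hj)]
        · rw [hcn j hjT]; exact abs_pos.2 ((hmemS j).1 hj)
      refine (sum_mul_sortedAbs_le hw b c).trans ?_
      gcongr
      set τ := (Tuple.sort (fun j => -|c j|)).symm with hτ
      have h1 : ∑ j, w (τ j) * (|c j| - |b j|) = -δ * ∑ j ∈ T, w (τ j) := by
        rw [Finset.mul_sum, ← Finset.sum_subset (Finset.subset_univ T)]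
        · exact Finset.sum_congr rfl fun j hj => by rw [hcT j hj]; ring
        · intro j _ hj
          rw [hcn j hj, sub_self, mul_zero]
      have h2 := sum_range_le_sum_of_lt hw (T.map (τ.toEmbedding.trans Fin.valEmbedding)) S.card
        (by
          intro k hk
          obtain ⟨j, hj, rfl⟩ := Finset.mem_map.1 hk
          exact (sort_symm_lt_card_iff c S hblock j).2 (hT hj))
      rw [Finset.card_map, Finset.sum_map] at h2
      simp only [Function.Embedding.trans_apply, Equiv.coe_toEmbedding,
        Fin.valEmbedding_apply] at h2
      rw [h1]
      nlinarith
  -- The value at z j = 0 is 1, not 0, so that every coordinate in T moves by exactly δ.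
  · set s : Fin m → ℝ := fun j => if 0 ≤ z j then 1 else -1 with hs
    have hsz : ∀ j, s j * z j = |z j| := fun j => by
      by_cases h : 0 ≤ z j
      · simp [hs, h, abs_of_nonneg h]
      · simp [hs, h, abs_of_neg (not_le.1 h)]
    have habs : ∀ j, |s j| = 1 := fun j => by
      by_cases h : 0 ≤ z j <;> simp [hs, h]
    have hbT : ∀ j ∈ T, b j = 0 := fun j hj => by
      have := Finset.disjoint_left.1 hTS hj
      simpa [hmemS] using this
    have key := sum_mul_le_of_isMinimizer hb
      (WithLp.toLp 2 fun j => if j ∈ T then s j else 0)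
      (∑ k ∈ Finset.range T.card, w (S.card + k)) ?_
    · simp only [ite_mul, zero_mul, Finset.sum_ite_mem, Finset.univ_inter] at key
      refine le_trans (le_of_eq (Finset.sum_congr rfl fun j hj => ?_)) key
      rw [hbT j hj, sub_zero, hsz]
    · filter_upwards [eventually_lt_abs b] with δ ⟨hδ, hδb⟩
      set c : EuclideanSpace ℝ (Fin m) :=
        b + δ • WithLp.toLp 2 fun j => if j ∈ T then s j else 0 with hc
      have hcT : ∀ j ∈ T, |c j| = δ := fun j hj => by
        simp [hc, hj, hbT j hj, habs, abs_mul, abs_of_pos hδ]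
      have hcn : ∀ j ∉ T, c j = b j := fun j hj => by simp [hc, hj]
      have hblock : ∀ j ∈ S, ∀ j' ∉ S, |c j'| < |c j| := by
        intro j hj j' hj'
        have hb' : b j' = 0 := by simpa [hmemS] using hj'
        rw [hcn j (Finset.disjoint_right.1 hTS hj)]
        by_cases hjT : j' ∈ T
        · rw [hcT j' hjT]; exact hδb j ((hmemS j).1 hj)
        · rw [hcn j' hjT, hb', abs_zero]; exact abs_pos.2 ((hmemS j).1 hj)
      refine (sum_mul_sortedAbs_le hw b c).trans ?_
      gcongr
      set τ := (Tuple.sort (fun j => -|c j|)).symm with hτ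
      have h1 : ∑ j, w (τ j) * (|c j| - |b j|) = δ * ∑ j ∈ T, w (τ j) := by
        rw [Finset.mul_sum, ← Finset.sum_subset (Finset.subset_univ T)]
        · exact Finset.sum_congr rfl fun j hj => by rw [hcT j hj, hbT j hj, abs_zero]; ring
        · intro j _ hj
          rw [hcn j hj, sub_self, mul_zero]
      have h2 := sum_le_sum_range_of_ge hw S.card (T.map (τ.toEmbedding.trans Fin.valEmbedding))
        (by
          intro k hk
          obtain ⟨j, hj, rfl⟩ := Finset.mem_map.1 hk
          exact not_lt.1 fun h =>
            Finset.disjoint_left.1 hTS hj ((sort_symm_lt_card_iff c S hblock j).1 h))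
      rw [Finset.card_map, Finset.sum_map] at h2
      simp only [Function.Embedding.trans_apply, Equiv.coe_toEmbedding,
        Fin.valEmbedding_apply] at h2
      rw [h1]
      exact mul_le_mul_of_nonneg_left h2 hδ.le

/-- For an orthonormal design the least squares term is, up to a constant, the squared distance
to `Xᵀ y`. -/
theorem norm_sub_mulVec_sq {n m : ℕ} {X : Matrix (Fin n) (Fin m) ℝ} (hX : Xᵀ * X = 1)
    (y : EuclideanSpace ℝ (Fin n)) (b : EuclideanSpace ℝ (Fin m)) :
    ‖y - WithLp.toLp 2 (X *ᵥ b)‖ ^ 2 =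
      ∑ k, y k ^ 2 - ∑ j, (Xᵀ *ᵥ y) j ^ 2 + ∑ j, ((Xᵀ *ᵥ y) j - b j) ^ 2 := by
  have h1 : ∑ k, (X *ᵥ b) k ^ 2 = ∑ j, b j ^ 2 := by
    have : (X *ᵥ b) ⬝ᵥ (X *ᵥ b) = (b : Fin m → ℝ) ⬝ᵥ b := by
      rw [Matrix.dotProduct_mulVec, Matrix.vecMul_mulVec, hX, Matrix.vecMul_one]
    simpa [dotProduct, sq] using this
  have h2 : ∑ k, y k * (X *ᵥ b) k = ∑ j, (Xᵀ *ᵥ y) j * b j := by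
    have : (y : Fin n → ℝ) ⬝ᵥ (X *ᵥ b) = (Xᵀ *ᵥ y) ⬝ᵥ (b : Fin m → ℝ) := by
      rw [Matrix.dotProduct_mulVec, Matrix.mulVec_transpose]
    simpa [dotProduct] using this
  rw [EuclideanSpace.real_norm_sq_eq]
  simp only [PiLp.sub_apply, sub_sq, Finset.sum_add_distrib, Finset.sum_sub_distrib, h1,
    mul_assoc, ← Finset.mul_sum, h2]
  ring

end FSlope

/-! ### Gaussian quantiles, tails and the F-SLOPE weights -/

namespace FSlope

theorem quantile_set_nonempty {p : ℝ} (hp : p < 1) :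
    {x : ℝ | p ≤ cdf (gaussianReal 0 1) x}.Nonempty :=
  (((tendsto_cdf_atTop (gaussianReal 0 1)).eventually (lt_mem_nhds hp)).exists).imp
    fun _ h => h.le

theorem quantile_set_bddBelow {p : ℝ} (hp : 0 < p) :
    BddBelow {x : ℝ | p ≤ cdf (gaussianReal 0 1) x} := by
  obtain ⟨a, ha⟩ :=
    ((tendsto_cdf_atBot (gaussianReal 0 1)).eventually (gt_mem_nhds hp)).exists
  refine ⟨a, fun x hx => le_of_not_gt fun h => ?_⟩
  exact absurd (hx.trans (monotone_cdf _ h.le)) (not_le.2 ha)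

/-- Right continuity of the distribution function: the bound holds at every point to the right of
the infimum, hence at the infimum. -/
theorem le_cdf_stdNormalQuantile {p : ℝ} (hp : p < 1) :
    p ≤ cdf (gaussianReal 0 1) (stdNormalQuantile p) := by
  rw [← (cdf (gaussianReal 0 1)).iInf_Ioi_eq]
  refine le_ciInf fun ⟨y, hy⟩ => ?_
  obtain ⟨x, hx, hxy⟩ := exists_lt_of_csInf_lt (quantile_set_nonempty hp) hy
  exact hx.trans (monotone_cdf _ hxy.le)

theorem stdNormalQuantile_mono {p p' : ℝ} (hp : 0 < p) (hp' : p' < 1) (h : p ≤ p') :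
    stdNormalQuantile p ≤ stdNormalQuantile p' :=
  csInf_le_csInf (quantile_set_bddBelow hp) (quantile_set_nonempty hp') fun _ hx => h.trans hx

theorem gaussianReal_abs_tail_le {p : ℝ} (hp : p < 1) :
    gaussianReal 0 1 {x | stdNormalQuantile p < |x|} ≤ ENNReal.ofReal (2 * (1 - p)) := by
  set a := stdNormalQuantile p with ha
  have h1 : gaussianReal 0 1 (Set.Ioi a) ≤ ENNReal.ofReal (1 - p) := by
    rw [← Set.compl_Iic, prob_compl_eq_one_sub measurableSet_Iic, ← ofReal_cdf,
      ← ENNReal.ofReal_one, ← ENNReal.ofReal_sub _ (cdf_nonneg _ _)]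
    exact ENNReal.ofReal_le_ofReal (by linarith [le_cdf_stdNormalQuantile hp])
  have h2 : gaussianReal 0 1 ((fun x => -x) ⁻¹' Set.Ioi a) = gaussianReal 0 1 (Set.Ioi a) := by
    conv_rhs => rw [← neg_zero, ← gaussianReal_map_neg]
    rw [Measure.map_apply measurable_neg measurableSet_Ioi]
  have h3 : {x | a < |x|} = Set.Ioi a ∪ (fun x => -x) ⁻¹' Set.Ioi a := by
    ext x
    exact lt_abs (a := a) (b := x)
  rw [h3, two_mul, ENNReal.ofReal_add (by linarith) (by linarith)]
  exact (measure_union_le _ _).trans (add_le_add h1 (h2.trans_le h1))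

theorem gaussianReal_abs_tail_smul_le {p : ℝ} (hp : p < 1) {σ : ℝ} (hσ : 0 ≤ σ) :
    gaussianReal 0 (σ ^ 2).toNNReal {x | σ * stdNormalQuantile p < |x|} ≤
      ENNReal.ofReal (2 * (1 - p)) := by
  have h := gaussianReal_map_const_mul (μ := 0) (v := 1) σ
  rw [mul_zero, mul_one] at h
  have hv : (σ ^ 2).toNNReal = .mk (σ ^ 2) (sq_nonneg σ) := Real.toNNReal_of_nonneg _
  rw [hv, ← h, Measure.map_apply (by fun_prop) (measurableSet_lt (by fun_prop) (by fun_prop))]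
  refine (measure_mono fun x hx => ?_).trans (gaussianReal_abs_tail_le hp)
  simp only [Set.mem_preimage, Set.mem_ofPred_eq, abs_mul, abs_of_nonneg hσ] at hx ⊢
  exact lt_of_mul_lt_mul_left hx hσ

/-- The argument `1 - level m γ α i` of the quantile function in the weight `λ_i`. -/
noncomputable def level (m : ℕ) (γ α : ℝ) (i : ℕ) : ℝ :=
  ((⌊γ * (i : ℝ)⌋₊ : ℝ) + 1) * α / (2 * ((m : ℝ) + (⌊γ * (i : ℝ)⌋₊ : ℝ) + 1 - (i : ℝ)))

theorem level_pos {m i : ℕ} (hi : i ≤ m) {γ α : ℝ} (hα : 0 < α) : 0 < level m γ α i := by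
  have : (i : ℝ) ≤ m := by exact_mod_cast hi
  have h0 : (0 : ℝ) ≤ ⌊γ * (i : ℝ)⌋₊ := Nat.cast_nonneg _
  exact div_pos (by positivity) (by linarith)

theorem level_lt_one {m i : ℕ} (hi : i ≤ m) {γ α : ℝ} (hα : α ∈ Set.Ioo (0 : ℝ) 1) :
    level m γ α i < 1 := by
  have : (i : ℝ) ≤ m := by exact_mod_cast hi
  have h0 : (0 : ℝ) ≤ ⌊γ * (i : ℝ)⌋₊ := Nat.cast_nonneg _
  rw [level, div_lt_one (by linarith)]
  nlinarith [hα.1, hα.2]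

theorem level_mono {m i j : ℕ} (hij : i ≤ j) (hj : j ≤ m) {γ α : ℝ} (hγ : 0 ≤ γ) (hα : 0 ≤ α) :
    level m γ α i ≤ level m γ α j := by
  have h1 : (i : ℝ) ≤ j := by exact_mod_cast hij
  have h2 : (j : ℝ) ≤ m := by exact_mod_cast hj
  have h0 : (0 : ℝ) ≤ ⌊γ * (i : ℝ)⌋₊ := Nat.cast_nonneg _
  have h3 : (⌊γ * (i : ℝ)⌋₊ : ℝ) ≤ ⌊γ * (j : ℝ)⌋₊ := by
    exact_mod_cast Nat.floor_mono (mul_le_mul_of_nonneg_left h1 hγ)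
  rw [level, level, div_le_div_iff₀ (by linarith) (by linarith)]
  set a : ℝ := (⌊γ * (i : ℝ)⌋₊ : ℝ)
  set b : ℝ := (⌊γ * (j : ℝ)⌋₊ : ℝ)
  -- The difference of the two sides is (b - a)(m - j) + (b + 1)(j - i).
  have h4 : (a + 1) * (m + b + 1 - j) ≤ (b + 1) * (m + a + 1 - i) := by
    nlinarith [mul_nonneg (sub_nonneg.2 h3) (sub_nonneg.2 h2),
      mul_nonneg (by linarith : 0 ≤ b + 1) (sub_nonneg.2 h1)]
  nlinarith

/-- Truncating at m extends the weights to all of ℕ by a constant; beyond m the denominator in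
`level` need not be positive. -/
theorem antitone_lam {m : ℕ} {γ α σ : ℝ} (hγ : 0 ≤ γ) (hα : α ∈ Set.Ioo (0 : ℝ) 1)
    (hσ : 0 ≤ σ) : Antitone fun k => σ * lam m γ α (min (k + 1) m) := by
  intro i j hij
  refine mul_le_mul_of_nonneg_left (stdNormalQuantile_mono ?_ ?_ ?_) hσ
  · exact sub_pos.2 (level_lt_one (min_le_right _ _) hα)
  · exact sub_lt_self _ (level_pos (min_le_right _ _) hα.1)
  · exact sub_le_sub_left (level_mono (by omega) (min_le_right _ _) hγ hα.1.le) _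

theorem gaussianReal_lam_tail_le {m i : ℕ} (hi : i ≤ m) {γ α σ : ℝ} (hα : 0 < α)
    (hσ : 0 ≤ σ) :
    gaussianReal 0 (σ ^ 2).toNNReal {x | σ * lam m γ α i < |x|} ≤
      ENNReal.ofReal (2 * level m γ α i) := by
  have := gaussianReal_abs_tail_smul_le (p := 1 - level m γ α i)
    (sub_lt_self _ (level_pos hi hα)) hσ
  rwa [sub_sub_cancel] at this

/-- The constants of the F-SLOPE weights are such that the bound on the expected number of false
selections, divided by the least number of false selections in question, is at most `α`. -/
theorem level_div_max_le {m m₀ i : ℕ} (hi : i ≤ m) (hm₀ : m₀ ≤ m) (hpos : 0 < m₀)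
    {γ α : ℝ} (hα : 0 < α) :
    1 / max ((⌊γ * (i : ℝ)⌋₊ : ℝ) + 1) ((i : ℝ) + m₀ - m) * (2 * level m γ α i) ≤ α / m₀ := by
  have h1 : (i : ℝ) ≤ m := by exact_mod_cast hi
  have h2 : (m₀ : ℝ) ≤ m := by exact_mod_cast hm₀
  have h3 : (0 : ℝ) < m₀ := by exact_mod_cast hpos
  have h0 : (0 : ℝ) ≤ ⌊γ * (i : ℝ)⌋₊ := Nat.cast_nonneg _
  rw [level]
  set k : ℝ := (⌊γ * (i : ℝ)⌋₊ : ℝ)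
  set c := max (k + 1) ((i : ℝ) + m₀ - m) with hc
  have hc1 : k + 1 ≤ c := le_max_left _ _
  have hd : 0 < (m : ℝ) + k + 1 - i := by linarith
  -- With d = m - i, right minus left is d(m₀ - d - (k + 1)) when c = m₀ - d, and (k + 1)(d + k + 1
  -- - m₀) when c = k + 1.
  have hkey : (k + 1) * m₀ ≤ c * (m + k + 1 - i) := by
    rcases le_total (k + 1) ((i : ℝ) + m₀ - m) with h | h
    · rw [hc, max_eq_right h]
      nlinarith [mul_nonneg (sub_nonneg.2 h) (sub_nonneg.2 h1)]
    · rw [hc, max_eq_left h]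
      nlinarith
  have hc0 : 0 < c := by linarith
  have : 1 / c * (2 * ((k + 1) * α / (2 * (m + k + 1 - i)))) =
      (k + 1) * α / (c * (m + k + 1 - i)) := by
    field_simp
  rw [this, div_le_div_iff₀ (by positivity) h3]
  nlinarith

end FSlope

/-! ### The probability bound for independent coordinates -/

namespace FSlope

theorem IsSelection.congr {ι : Type*} {w : ℕ → ℝ} {U S : Finset ι} {z z' : ι → ℝ}
    (hz : ∀ j ∈ U, z j = z' j) (h : IsSelection w U S z) : IsSelection w U S z' := by
  have key : ∀ T ⊆ U, ∑ j ∈ T, |z' j| = ∑ j ∈ T, |z j| := fun T hT =>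
    Finset.sum_congr rfl fun j hj => by rw [hz j (hT hj)]
  refine ⟨h.1, fun T hT hTn => ?_, fun T hT hTS => ?_⟩
  · rw [key T (hT.trans h.1)]; exact h.2.1 T hT hTn
  · rw [key T hT]; exact h.2.2 T hT hTS

variable {Ω ι : Type*} [MeasurableSpace Ω]

theorem measurableSet_isSelection_comp (w : ℕ → ℝ) (U S : Finset ι) {Z : ι → Ω → ℝ}
    (hZ : ∀ i, Measurable (Z i)) : MeasurableSet {ω | IsSelection w U S fun j => Z j ω} :=
  (measurable_pi_lambda (fun ω j => Z j ω) hZ) (measurableSet_isSelection w U S)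

variable [DecidableEq ι]

theorem measure_abs_inter_isSelection {μ : Measure Ω} {Z : ι → Ω → ℝ}
    (hZ : ∀ i, Measurable (Z i)) (hind : iIndepFun Z μ) (a : ℝ) (w : ℕ → ℝ) {i : ι}
    {U S : Finset ι} (hi : i ∉ U) :
    μ ({ω | a < |Z i ω|} ∩ {ω | IsSelection w U S fun j => Z j ω}) =
      μ {ω | a < |Z i ω|} * μ {ω | IsSelection w U S fun j => Z j ω} := by
  have h := hind.indepFun_finset {i} U (Finset.disjoint_singleton_left.2 hi) hZ
  -- Selection within U ignores coordinates outside U, so extending by 0 exhibits it as an event in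
  -- the coordinates of U only.
  let e : (U → ℝ) → ι → ℝ := fun z j => if hj : j ∈ U then z ⟨j, hj⟩ else 0
  have he : Measurable e := by
    refine measurable_pi_lambda _ fun j => ?_
    by_cases hj : j ∈ U
    · simpa [e, hj] using measurable_pi_apply _
    · simp [e, hj]
  have h1 : MeasurableSet {x : ({i} : Finset ι) → ℝ | a < |x ⟨i, Finset.mem_singleton_self i⟩|} :=
    measurableSet_lt measurable_const (measurable_pi_apply _).abs
  have h2 : {ω | IsSelection w U S fun j => Z j ω} =
      (fun ω (j : U) => Z j ω) ⁻¹' (e ⁻¹' {z | IsSelection w U S z}) := by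
    ext ω
    constructor
    · exact IsSelection.congr fun j hj => by simp [e, hj]
    · exact IsSelection.congr fun j hj => by simp [e, hj]
  rw [h2]
  exact h.measure_inter_preimage_eq_mul _ _ h1 (he (measurableSet_isSelection w U S))

theorem sum_measure_isSelection_le_one {μ : Measure Ω} [IsProbabilityMeasure μ] {Z : ι → Ω → ℝ}
    (hZ : ∀ i, Measurable (Z i)) {w : ℕ → ℝ} (hw : Antitone w) (U : Finset ι)
    (F : Finset (Finset ι)) :
    ∑ S ∈ F, μ {ω | IsSelection w U S fun j => Z j ω} ≤ 1 := by
  rw [← measure_biUnion_finset]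
  · exact prob_le_one
  · intro S _ S' _ hne
    refine Set.disjoint_left.2 fun ω h h' => hne (IsSelection.eq hw h h')
  · exact fun S _ => measurableSet_isSelection_comp w U S hZ

/-- If a set of indices is selected for independent coordinates, with two-sided tail bounds
`2 * level` for the null coordinates `i ∈ N`, then the proportion of null coordinates among the
selected ones exceeds `γ` with probability at most `α`. -/
theorem measure_isSelection_le {m : ℕ} {μ : Measure Ω} [IsProbabilityMeasure μ]
    {Z : Fin m → Ω → ℝ} (hZ : ∀ i, Measurable (Z i)) (hind : iIndepFun Z μ)
    {w : ℕ → ℝ} (hw : Antitone w) (N : Finset (Fin m)) {γ α : ℝ} (hγ : 0 ≤ γ) (hα : 0 < α)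
    (htail : ∀ i ∈ N, ∀ r < m,
      μ {ω | w r < |Z i ω|} ≤ ENNReal.ofReal (2 * level m γ α (r + 1))) :
    μ {ω | ∃ S, IsSelection w Finset.univ S (fun j => Z j ω) ∧ γ * S.card < (S ∩ N).card} ≤
      ENNReal.ofReal α := by
  rcases N.eq_empty_or_nonempty with rfl | hN
  · refine le_of_eq_of_le ?_ zero_le
    rw [← measure_empty (μ := μ)]
    congr 1
    ext ω
    simp only [Finset.inter_empty, Finset.card_empty, Nat.cast_zero, Set.mem_ofPred_eq,
      Set.mem_empty_iff_false, iff_false, not_exists, not_and, not_lt]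
    intros
    positivity
  -- Reciprocal of the least possible V when R = r and V > γr: V is an integer, and at most m - |N|
  -- selected coordinates are not null.
  set c : ℕ → ℝ := fun r => 1 / max ((⌊γ * (r : ℝ)⌋₊ : ℝ) + 1) ((r : ℝ) + N.card - m) with hc
  have hmax : ∀ r : ℕ, 0 < max ((⌊γ * (r : ℝ)⌋₊ : ℝ) + 1) ((r : ℝ) + N.card - m) :=
    fun r => lt_max_of_lt_left (by positivity)
  have hc0 : ∀ r, 0 < c r := fun r => one_div_pos.2 (hmax r)
  have hNm : N.card ≤ m := by simpa using Finset.card_le_univ N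
  -- Here S stands for the selection without i, so the full selection has |S| + 1 elements and its
  -- smallest weight in use is `w S.card`.
  let A : Fin m → Finset (Fin m) → Set Ω := fun i S =>
    {ω | w S.card < |Z i ω|} ∩
      {ω | IsSelection (fun k => w (k + 1)) (Finset.univ.erase i) S fun j => Z j ω}
  have hA : ∀ i S, MeasurableSet (A i S) := fun i S =>
    (measurableSet_lt measurable_const (hZ i).abs).inter (measurableSet_isSelection_comp _ _ _ hZ)
  let f : Ω → ENNReal := fun ω => ∑ i ∈ N, ∑ S ∈ (Finset.univ.erase i).powerset,
    ENNReal.ofReal (c (S.card + 1)) * (A i S).indicator 1 ω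
  have hfm : ∀ i S, Measurable fun ω =>
      ENNReal.ofReal (c (S.card + 1)) * (A i S).indicator (1 : Ω → ENNReal) ω := fun i S =>
    (measurable_one.indicator (hA i S)).const_mul _
  have hf : Measurable f :=
    Finset.measurable_sum _ fun i _ => Finset.measurable_sum _ fun S _ => hfm i S
  have hsub : {ω | ∃ S, IsSelection w Finset.univ S (fun j => Z j ω) ∧
      γ * S.card < (S ∩ N).card} ⊆ {ω | 1 ≤ f ω} := by
    rintro ω ⟨S, hS, hV⟩
    have hterm : ∀ i ∈ S ∩ N, ENNReal.ofReal (c S.card) ≤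
        ∑ T ∈ (Finset.univ.erase i).powerset,
          ENNReal.ofReal (c (T.card + 1)) * (A i T).indicator 1 ω := by
      intro i hi
      have hiS := (Finset.mem_inter.1 hi).1
      have hcard := Finset.card_erase_add_one hiS
      have hmem : ω ∈ A i (S.erase i) := by
        refine ⟨?_, hS.erase hiS⟩
        have := hS.lt_abs hiS
        rwa [← hcard, Nat.add_sub_cancel] at this
      refine le_trans (le_of_eq ?_) (Finset.single_le_sum
        (f := fun T => ENNReal.ofReal (c (T.card + 1)) * (A i T).indicator 1 ω)
        (fun _ _ => zero_le) (Finset.mem_powerset.2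
          (Finset.erase_subset_erase i (Finset.subset_univ S))))
      simp [hmem, hcard]
    have hcount : max ((⌊γ * (S.card : ℝ)⌋₊ : ℝ) + 1) ((S.card : ℝ) + N.card - m) ≤
        (S ∩ N).card := by
      refine max_le ?_ ?_
      · exact_mod_cast (Nat.floor_lt (by positivity)).2 hV
      · have h1 := Finset.card_union_add_card_inter S N
        have h2 : (S ∪ N).card ≤ m := by simpa using Finset.card_le_univ (S ∪ N)
        rw [sub_le_iff_le_add]
        exact_mod_cast (by omega : S.card + N.card ≤ (S ∩ N).card + m)
    calc (1 : ENNReal) ≤ (S ∩ N).card • ENNReal.ofReal (c S.card) := by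
          rw [nsmul_eq_mul, ← ENNReal.ofReal_natCast, ← ENNReal.ofReal_mul (Nat.cast_nonneg _),
            ENNReal.one_le_ofReal, hc]
          simp only
          rw [mul_one_div, one_le_div (hmax _)]
          exact hcount
      _ ≤ ∑ i ∈ S ∩ N, ∑ T ∈ (Finset.univ.erase i).powerset,
          ENNReal.ofReal (c (T.card + 1)) * (A i T).indicator 1 ω :=
        Finset.card_nsmul_le_sum _ _ _ hterm
      _ ≤ f ω := Finset.sum_le_sum_of_subset Finset.inter_subset_right
  have hint : ∫⁻ ω, f ω ∂μ = ∑ i ∈ N, ∑ S ∈ (Finset.univ.erase i).powerset,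
      ENNReal.ofReal (c (S.card + 1)) * μ (A i S) := by
    rw [lintegral_finsetSum _ fun i _ => Finset.measurable_sum _ fun S _ => hfm i S]
    refine Finset.sum_congr rfl fun i _ => ?_
    rw [lintegral_finsetSum _ fun S _ => hfm i S]
    refine Finset.sum_congr rfl fun S _ => ?_
    rw [lintegral_const_mul _ (measurable_one.indicator (hA i S)), lintegral_indicator_one (hA i S)]
  have hbound : ∀ i ∈ N, ∑ S ∈ (Finset.univ.erase i).powerset,
      ENNReal.ofReal (c (S.card + 1)) * μ (A i S) ≤ ENNReal.ofReal (α / N.card) := by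
    intro i hi
    calc _ ≤ ∑ S ∈ (Finset.univ.erase i).powerset, ENNReal.ofReal (α / N.card) *
          μ {ω | IsSelection (fun k => w (k + 1)) (Finset.univ.erase i) S fun j => Z j ω} := by
          refine Finset.sum_le_sum fun S hS => ?_
          have hSm : S.card < m := by
            have h1 := Finset.card_le_card (Finset.mem_powerset.1 hS)
            rw [Finset.card_erase_of_mem (Finset.mem_univ i), Finset.card_univ,
              Fintype.card_fin] at h1
            have := i.pos
            omega
          rw [measure_abs_inter_isSelection hZ hind _ _ (Finset.notMem_erase i _), ← mul_assoc]
          refine mul_le_mul_left ?_ _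
          refine (mul_le_mul_right (htail i hi _ hSm) _).trans ?_
          rw [← ENNReal.ofReal_mul (hc0 _).le]
          exact ENNReal.ofReal_le_ofReal (level_div_max_le hSm hNm hN.card_pos hα)
      _ ≤ ENNReal.ofReal (α / N.card) := by
          rw [← Finset.mul_sum]
          exact mul_le_of_le_one_right' (sum_measure_isSelection_le_one hZ
            (fun a b hab => hw (Nat.succ_le_succ hab)) _ _)
  calc _ ≤ μ {ω | 1 ≤ f ω} := measure_mono hsub
    _ ≤ ∫⁻ ω, f ω ∂μ := by simpa using mul_meas_ge_le_lintegral (μ := μ) hf 1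
    _ ≤ ∑ i ∈ N, ENNReal.ofReal (α / N.card) := hint.trans_le (Finset.sum_le_sum hbound)
    _ = ENNReal.ofReal α := by
      have : (0 : ℝ) < N.card := by exact_mod_cast hN.card_pos
      rw [Finset.sum_const, nsmul_eq_mul, ← ENNReal.ofReal_natCast,
        ← ENNReal.ofReal_mul (Nat.cast_nonneg _), mul_div_cancel₀ _ this.ne']

end FSlope

/-! ### Orthonormal designs and Gaussian noise -/

namespace FSlope

open scoped RealInnerProductSpace

/-- The columns of a matrix, as Euclidean vectors. -/
noncomputable def column {n m : ℕ} (X : Matrix (Fin n) (Fin m) ℝ) (i : Fin m) :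
    EuclideanSpace ℝ (Fin n) :=
  WithLp.toLp 2 fun k => X k i

theorem inner_column {n m : ℕ} (X : Matrix (Fin n) (Fin m) ℝ) (i : Fin m)
    (e : EuclideanSpace ℝ (Fin n)) : ⟪column X i, e⟫ = (Xᵀ *ᵥ e) i := by
  simp [column, PiLp.inner_apply, Matrix.mulVec, dotProduct, mul_comm]

theorem posSemidef_sq_smul_one {n : ℕ} (σ : ℝ) :
    (σ ^ 2 • (1 : Matrix (Fin n) (Fin n) ℝ)).PosSemidef :=
  Matrix.PosSemidef.one.smul (sq_nonneg σ)

theorem covariance_inner_column {n m : ℕ} {X : Matrix (Fin n) (Fin m) ℝ} (hX : Xᵀ * X = 1)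
    (σ : ℝ) (i j : Fin m) :
    cov[fun e => ⟪column X i, e⟫, fun e => ⟪column X j, e⟫;
      multivariateGaussian 0 (σ ^ 2 • (1 : Matrix (Fin n) (Fin n) ℝ))] =
      if i = j then σ ^ 2 else 0 := by
  rw [← covarianceBilin_apply_eq_cov IsGaussian.memLp_two_id,
    covarianceBilin_multivariateGaussian (posSemidef_sq_smul_one σ), Matrix.smul_mulVec,
    Matrix.one_mulVec, dotProduct_smul]
  have h : (column X i : Fin n → ℝ) ⬝ᵥ column X j = (Xᵀ * X) i j := by
    simp [column, Matrix.mul_apply, dotProduct]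
  rw [h, hX, Matrix.one_apply]
  split_ifs <;> simp

/-- The coordinates are jointly Gaussian as a linear image of the noise, and uncorrelated because
the columns are orthogonal. -/
theorem iIndepFun_inner_column {n m : ℕ} {X : Matrix (Fin n) (Fin m) ℝ} (hX : Xᵀ * X = 1)
    (σ : ℝ) :
    iIndepFun (fun i e => ⟪column X i, e⟫)
      (multivariateGaussian 0 (σ ^ 2 • (1 : Matrix (Fin n) (Fin n) ℝ))) := by
  refine HasGaussianLaw.iIndepFun_of_covariance_eq_zero ?_ fun i j hij => ?_
  · have := (IsGaussian.hasGaussianLaw_id (μ := multivariateGaussian 0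
      (σ ^ 2 • (1 : Matrix (Fin n) (Fin n) ℝ)))).map
      (ContinuousLinearMap.pi fun i => innerSL ℝ (column X i))
    exact this
  · rw [covariance_inner_column hX, if_neg hij]

theorem map_inner_column {n m : ℕ} {X : Matrix (Fin n) (Fin m) ℝ} (hX : Xᵀ * X = 1)
    (σ : ℝ) (i : Fin m) :
    (multivariateGaussian 0 (σ ^ 2 • (1 : Matrix (Fin n) (Fin n) ℝ))).map
      (fun e => ⟪column X i, e⟫) = gaussianReal 0 (σ ^ 2).toNNReal := by
  have h := IsGaussian.map_eq_gaussianReal (μ := multivariateGaussian 0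
    (σ ^ 2 • (1 : Matrix (Fin n) (Fin n) ℝ))) (innerSL ℝ (column X i))
  rw [(innerSL ℝ (column X i)).integral_comp_id_comm IsGaussian.integrable_id,
    integral_id_multivariateGaussian, map_zero] at h
  have hv : Var[innerSL ℝ (column X i);
      multivariateGaussian 0 (σ ^ 2 • (1 : Matrix (Fin n) (Fin n) ℝ))] = σ ^ 2 := by
    rw [← covariance_self (by fun_prop)]
    simpa using covariance_inner_column hX σ i i
  rw [hv] at h
  exact h

open Classical in
/-- The support of an F-SLOPE estimate for an orthonormal design is the selection at `Xᵀ y`. -/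
theorem IsEstimate.isSelection {n m : ℕ} {X : Matrix (Fin n) (Fin m) ℝ} (hX : Xᵀ * X = 1)
    {σ γ α : ℝ} (hw : Antitone fun k => σ * lam m γ α (min (k + 1) m))
    {y : EuclideanSpace ℝ (Fin n)} {b : EuclideanSpace ℝ (Fin m)}
    (hb : IsEstimate X σ γ α y b) :
    IsSelection (fun k => σ * lam m γ α (min (k + 1) m)) Finset.univ
      (Finset.univ.filter fun j => b j ≠ 0) (Xᵀ *ᵥ y) := by
  refine isSelection_support_of_isMinimizer hw fun b' => ?_
  have h := hb b'
  have hpen : ∀ c : EuclideanSpace ℝ (Fin m),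
      ∑ i : Fin m, σ * lam m γ α (min ((i : ℕ) + 1) m) * sortedAbs c i =
        σ * ∑ i : Fin m, lam m γ α ((i : ℕ) + 1) * sortedAbs c i := fun c => by
    rw [Finset.mul_sum]
    refine Finset.sum_congr rfl fun i _ => ?_
    rw [min_eq_left i.isLt, mul_assoc]
  rw [objective, objective, norm_sub_mulVec_sq hX, norm_sub_mulVec_sq hX] at h
  simp only [hpen]
  linarith

open Classical in
theorem mul_card_lt_of_lt_fdp {m : ℕ} {β b : EuclideanSpace ℝ (Fin m)} {γ : ℝ} (hγ : 0 ≤ γ)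
    (h : γ < fdp β b) :
    γ * (Finset.univ.filter fun j => b j ≠ 0).card <
      ((Finset.univ.filter fun j => b j ≠ 0) ∩ Finset.univ.filter fun j => β j = 0).card := by
  rw [fdp, lt_div_iff₀ (by positivity)] at h
  rw [← Finset.filter_and]
  refine lt_of_le_of_lt (mul_le_mul_of_nonneg_left ?_ hγ) h
  rw [Nat.cast_le, numSelected]
  convert! le_max_left _ _

end FSlope

theorem theorem5 {n m : ℕ} (X : Matrix (Fin n) (Fin m) ℝ) (hX : Xᵀ * X = 1)
    (β : EuclideanSpace ℝ (Fin m)) (σ : ℝ) (hσ : 0 ≤ σ)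
    (α γ : ℝ) (hα : α ∈ Set.Ioo (0 : ℝ) 1) (hγ : γ ∈ Set.Ioo (0 : ℝ) 1)
    {Ω : Type*} [MeasurableSpace Ω] (P : Measure Ω) [IsProbabilityMeasure P]
    (ε : Ω → EuclideanSpace ℝ (Fin n))
    (hε : HasLaw ε (multivariateGaussian 0 (σ ^ 2 • (1 : Matrix (Fin n) (Fin n) ℝ))) P)
    (y : Ω → EuclideanSpace ℝ (Fin n)) (hy : ∀ ω, y ω = WithLp.toLp 2 (X *ᵥ β) + ε ω)
    (βhat : Ω → EuclideanSpace ℝ (Fin m))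
    (hβhat : ∀ ω, FSlope.IsEstimate X σ γ α (y ω) (βhat ω)) :
    P {ω | γ < FSlope.fdp β (βhat ω)} ≤ ENNReal.ofReal α := by
  classical
  let μ := multivariateGaussian 0 (σ ^ 2 • (1 : Matrix (Fin n) (Fin n) ℝ))
  set w : ℕ → ℝ := fun k => σ * FSlope.lam m γ α (min (k + 1) m) with hw
  have hanti : Antitone w := FSlope.antitone_lam hγ.1.le hα hσ
  let Z : Fin m → EuclideanSpace ℝ (Fin n) → ℝ := fun i e => β i + inner ℝ (FSlope.column X i) e
  have hZ : ∀ i, Measurable (Z i) := fun i => by fun_prop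
  have hind : iIndepFun Z μ :=
    (FSlope.iIndepFun_inner_column hX σ).comp (fun i x => β i + x) fun i => by fun_prop
  set N : Finset (Fin m) := Finset.univ.filter fun j => β j = 0 with hN
  have htail : ∀ i ∈ N, ∀ r < m,
      μ {e | w r < |Z i e|} ≤ ENNReal.ofReal (2 * FSlope.level m γ α (r + 1)) := by
    intro i hi r hr
    have hβ : β i = 0 := by simpa [hN] using hi
    have h := FSlope.gaussianReal_lam_tail_le (γ := γ) (Nat.succ_le_of_lt hr) hα.1 hσ
    rw [← FSlope.map_inner_column hX σ i, Measure.map_apply (by fun_prop)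
      (measurableSet_lt (by fun_prop) (by fun_prop))] at h
    simpa [Z, hβ, hw, min_eq_left (Nat.succ_le_of_lt hr)] using h
  have hmain := FSlope.measure_isSelection_le hZ hind hanti N hγ.1.le hα.1 htail
  refine le_trans ?_ hmain
  rw [← show P.map ε = μ from hε.map_eq]
  -- The FDP event need not be measurable; it lies in the preimage under ε of the selection event,
  -- and this inequality holds for arbitrary sets.
  refine le_trans (measure_mono fun ω hω => ?_) (Measure.le_map_apply hε.aemeasurable _)
  have hsel := (hβhat ω).isSelection hX hanti
  have hz : (Xᵀ *ᵥ (y ω)) = fun j => Z j (ε ω) := by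
    ext j
    simp only [Z, FSlope.inner_column, hy ω, WithLp.ofLp_add, Matrix.mulVec_add,
      Matrix.mulVec_mulVec, hX, Matrix.one_mulVec, Pi.add_apply]
  rw [hz] at hsel
  exact ⟨_, hsel, FSlope.mul_card_lt_of_lt_fdp hγ.1.le hω⟩
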